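/- Let $U$ be a real Banach space and $V$ a real Hilbert space. Let $\psi$ be a function from a set $\operatorname{dom}\psi\subseteq U\times V$ to $V$, and let $(\bar u,\bar v)\in\operatorname{int}\operatorname{dom}\psi$ satisfy $\psi(\bar u,\bar v)=0$. Assume that there are neighborhoods $\mathcal B_U$ of $\bar u$ and $\mathcal B_V$ of $\bar v$ and constants $\tau>0$ and $L\ge 0$ such that (a) $\psi$ is continuous on $(\mathcal B_U\times\mathcal B_V)\cap\operatorname{dom}\psi$; (b) $\psi(u,\cdot)$ is strongly monotone on $\mathcal B_V$ with modulus $\tau$, uniformly in $u\in\mathcal B_U$, that is, $\langle \psi(u,v_1)-\psi(u,v_2),\,v_1-v_2\rangle\ge\tau\|v_1-v_2\|^2$ for all $u\in\mathcal B_U$ and $v_1,v_2\in\mathcal B_V$ with $(u,v_1),(u,v_2)\in\operatorname{dom}\psi$; (c) $\psi(\cdot,v)$ is Lipschitz continuous with constant $L$, uniformly in $v\in\mathcal B_V$, that is, $\|\psi(u_1,v)-\psi(u_2,v)\|\le L\|u_1-u_2\|$ for all $v\in\mathcal B_V$ and $u_1,u_2\in U$ with $(u_1,v),(u_2,v)\in\operatorname{dom}\psi$.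 Let $S(u)=\{v\in V:(u,v)\in\operatorname{dom}\psi,\ \psi(u,v)=0\}$ for $u\in U$. Then $S$ has a single-valued localization around $\bar u$ for $\bar v$ that is Lipschitz continuous with constant $L/\tau$: there are neighborhoods $Q$ of $\bar u$ and $W$ of $\bar v$ and a function $s:Q\to V$ such that $s(\bar u)=\bar v$, $S(u)\cap W=\{s(u)\}$ for all $u\in Q$, and $$\|s(u')-s(u'')\|\le\frac{L}{\tau}\,\|u'-u''\|\qquad\text{for all }u',u''\in Q.$$ -/

import Mathlib

open Topology
open scoped NNReal

/-- `F` is strongly monotone on `B` with modulus `τ` (used with `0 < τ`). -/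
def StronglyMonotoneOn {V : Type*} [NormedAddCommGroup V] [InnerProductSpace ℝ V]
    (τ : ℝ≥0) (F : V → V) (B : Set V) : Prop :=
  ∀ v₁ ∈ B, ∀ v₂ ∈ B, (τ : ℝ) * ‖v₁ - v₂‖ ^ 2 ≤ inner ℝ (F v₁ - F v₂) (v₁ - v₂)

/-- The solution mapping `S(u) = {v | ψ(u, v) = 0}` of a function `ψ` with domain `D`;
values of `ψ` outside `D` are disregarded. -/
def solutionMap {U V : Type*} [Zero V] (D : Set (U × V)) (ψ : U × V → V) (u : U) : Set V :=
  {v | (u, v) ∈ D ∧ ψ (u, v) = 0}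

/-- On the neighborhood `Q` of `u₀`, the truncation `u ↦ S(u) ∩ W` of the set-valued mapping `S`
to the neighborhood `W` of `v₀` is the single-valued function `s`, and `s u₀ = v₀`. -/
structure IsSingleValuedLocalization {U V : Type*} [TopologicalSpace U] [TopologicalSpace V]
    (S : U → Set V) (u₀ : U) (v₀ : V) (Q : Set U) (W : Set V) (s : U → V) : Prop where
  mem_nhds_left : Q ∈ 𝓝 u₀
  mem_nhds_right : W ∈ 𝓝 v₀
  apply_eq : s u₀ = v₀
  inter_eq : ∀ u ∈ Q, S u ∩ W = {s u}

/-! For `u` near `u₀`, the map `ψ (u, ·)` is continuous and strongly monotone on a fixed closed ball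
`W` around `v₀`, and its value at `v₀` has norm at most `L * ‖u - u₀‖`. Once this is below `τ * r`,
where `r` is the radius of `W`, a zero in `W` exists: finitely many Minty inequalities are solvable
by a minimax argument on a simplex, weak-* compactness yields all of them at once, and continuity
turns Minty's inequality into Stampacchia's, whose solution is interior to `W` and hence a zero.
Strong monotonicity in `v` combined with the Lipschitz bound in `u` gives `τ * ‖v₁ - v₂‖ ≤ L * ‖u₁ -
u₂‖` for zeros, hence both uniqueness and the constant `L / τ`. -/

/-- If the symmetric part of a real matrix `A` has nonnegative entries, then `A` maps some point of
the standard simplex into the nonnegative orthant. -/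
theorem exists_mem_stdSimplex_sum_mul_nonneg {ι : Type*} [Fintype ι] [Nonempty ι]
    (A : ι → ι → ℝ) (hA : ∀ i j, 0 ≤ A i j + A j i) :
    ∃ c ∈ stdSimplex ℝ ι, ∀ i, 0 ≤ ∑ j, c j * A i j := by
  classical
  by_contra! hcon
  let T : (ι → ℝ) →ₗ[ℝ] (ι → ℝ) :=
    { toFun := fun c i => ∑ j, c j * A i j
      map_add' := fun x y => by
        funext i
        simp [add_mul, Finset.sum_add_distrib]
      map_smul' := fun a x => by
        funext i
        simp [Finset.mul_sum, mul_assoc] }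
  have hTc : Continuous T := T.continuous_of_finiteDimensional
  have hdisj : Disjoint (T '' stdSimplex ℝ ι) (Set.Ici (0 : ι → ℝ)) := by
    rw [Set.disjoint_left]
    rintro _ ⟨c, hc, rfl⟩ hpos
    obtain ⟨i, hi⟩ := hcon c hc
    exact absurd (hpos i) (not_le.mpr hi)
  obtain ⟨g, a, b, hga, hab, hgb⟩ := geometric_hahn_banach_compact_closed
    ((convex_stdSimplex ℝ ι).linear_image T) ((isCompact_stdSimplex ℝ ι).image hTc)
    (convex_Ici (0 : ι → ℝ)) isClosed_Ici hdisj
  have hb : b < 0 := by simpa using hgb 0 (Set.mem_Ici.mpr le_rfl)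
  set m : ι → ℝ := fun i => g (Pi.single i 1) with hm
  have hg : ∀ x, g x = ∑ i, x i * m i := by
    intro x
    conv_lhs => rw [pi_eq_sum_univ' x, map_sum]
    refine Finset.sum_congr rfl fun i _ => ?_
    rw [map_smul, smul_eq_mul, hm]
  have hm0 : ∀ i, 0 ≤ m i := by
    intro i
    by_contra! hi
    -- If `m i < 0`, this point lies in the orthant and `g` takes the value `b` there, against
    -- strict separation.
    have h := hgb ((b / m i) • Pi.single i 1) (by
      rw [Set.mem_Ici]
      exact smul_nonneg (div_nonneg_of_nonpos hb.le hi.le) (by simp))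
    rw [map_smul, smul_eq_mul] at h
    change b < b / m i * m i at h
    rw [div_mul_cancel₀ _ hi.ne] at h
    exact lt_irrefl _ h
  have hneg : ∀ c ∈ stdSimplex ℝ ι, ∑ i, (∑ j, c j * A i j) * m i < 0 := by
    intro c hc
    have h := hga _ (Set.mem_image_of_mem T hc)
    rw [hg] at h
    exact h.trans (hab.trans hb)
  have hs0 : 0 ≤ ∑ i, m i := Finset.sum_nonneg fun i _ => hm0 i
  rcases hs0.eq_or_lt with hs | hs
  · have hz : ∀ i, m i = 0 := fun i =>
      (Finset.sum_eq_zero_iff_of_nonneg fun i _ => hm0 i).mp hs.symm i (Finset.mem_univ i)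
    have h := hneg _ (single_mem_stdSimplex ℝ (Classical.arbitrary ι))
    simp [hz] at h
  -- The separating functional, normalized, is itself a test point of the simplex: the quadratic
  -- form of `A` would be negative at `m`, yet it depends only on the symmetric part and `m` is
  -- nonnegative.
  · have h := hneg (fun i => (∑ k, m k)⁻¹ * m i)
      ⟨fun i => mul_nonneg (inv_nonneg.mpr hs0) (hm0 i), by
        rw [← Finset.mul_sum, inv_mul_cancel₀ hs.ne']⟩
    have heq : ∑ i, (∑ j, (∑ k, m k)⁻¹ * m j * A i j) * m i
        = (∑ k, m k)⁻¹ * ∑ i, ∑ j, m i * m j * A i j := by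
      simp only [Finset.sum_mul, Finset.mul_sum]
      exact Finset.sum_congr rfl fun i _ => Finset.sum_congr rfl fun j _ => by ring
    have hsymm : (∑ i, ∑ j, m i * m j * A i j) + ∑ i, ∑ j, m i * m j * A i j
        = ∑ i, ∑ j, m i * m j * (A i j + A j i) := by
      conv_lhs =>
        arg 2
        rw [Finset.sum_comm]
      simp only [← Finset.sum_add_distrib]
      exact Finset.sum_congr rfl fun i _ => Finset.sum_congr rfl fun j _ => by ring
    have hpos : 0 ≤ ∑ i, ∑ j, m i * m j * (A i j + A j i) :=
      Finset.sum_nonneg fun i _ => Finset.sum_nonneg fun j _ =>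
        mul_nonneg (mul_nonneg (hm0 i) (hm0 j)) (hA i j)
    rw [heq] at h
    have h' := mul_nonneg (inv_nonneg.mpr hs0)
      (show 0 ≤ ∑ i, ∑ j, m i * m j * A i j by linarith)
    linarith

section Hilbert

variable {V : Type*} [NormedAddCommGroup V] [InnerProductSpace ℝ V]

/-- For `A i j = ⟪f (w i), w i - w j⟫`, monotonicity says exactly that `A i j + A j i` is
nonnegative; the simplex weights then give `v` as a convex combination of the `w j`. -/
theorem exists_mem_forall_inner_nonneg_of_finite {ι : Type*} [Fintype ι] [Nonempty ι] {K : Set V}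
    (hK : Convex ℝ K) {f : V → V}
    (hf : ∀ v ∈ K, ∀ w ∈ K, 0 ≤ inner ℝ (f v - f w) (v - w)) (w : ι → V) (hw : ∀ i, w i ∈ K) :
    ∃ v ∈ K, ∀ i, 0 ≤ inner ℝ (f (w i)) (w i - v) := by
  obtain ⟨c, hc, hcA⟩ := exists_mem_stdSimplex_sum_mul_nonneg
    (fun i j => inner ℝ (f (w i)) (w i - w j)) (fun i j => by
      have h := hf _ (hw i) _ (hw j)
      rw [inner_sub_left] at h
      rw [← neg_sub (w i) (w j), inner_neg_right]
      linarith)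
  refine ⟨∑ j, c j • w j, hK.sum_mem (fun j _ => hc.1 j) hc.2 fun j _ => hw j, fun i => ?_⟩
  have h : w i - ∑ j, c j • w j = ∑ j, c j • (w i - w j) := by
    simp only [smul_sub, Finset.sum_sub_distrib, ← Finset.sum_smul, hc.2, one_smul]
  rw [h, inner_sum]
  simpa only [inner_smul_right] using hcA i

/-- **Minty variational inequality** on a closed ball of a Hilbert space. -/
theorem exists_mem_closedBall_forall_inner_nonneg [CompleteSpace V] {v₀ : V} {r : ℝ} (hr : 0 ≤ r)
    {f : V → V}
    (hf : ∀ v ∈ Metric.closedBall v₀ r, ∀ w ∈ Metric.closedBall v₀ r,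
      0 ≤ inner ℝ (f v - f w) (v - w)) :
    ∃ v ∈ Metric.closedBall v₀ r, ∀ w ∈ Metric.closedBall v₀ r, 0 ≤ inner ℝ (f w) (w - v) := by
  -- Through the Riesz isometry the ball becomes weak-* compact and each Minty inequality a weak-*
  -- closed half-space, so finite intersections suffice.
  let e := InnerProductSpace.toDual ℝ V
  let C : Set (WeakDual ℝ V) := WeakDual.toStrongDual ⁻¹' Metric.closedBall (e v₀) r
  have hC : IsCompact C := WeakDual.isCompact_closedBall (e v₀) r
  let H : Metric.closedBall v₀ r → Set (WeakDual ℝ V) :=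
    fun w => {φ | φ (f w) ≤ inner ℝ (f (w : V)) (w : V)}
  have hH : ∀ w, IsClosed (H w) := fun w =>
    isClosed_le (WeakDual.eval_continuous (f w)) continuous_const
  have hmem : ∀ v : V, v ∈ Metric.closedBall v₀ r →
      (StrongDual.toWeakDual (e v)) ∈ C := by
    intro v hv
    change dist (e v) (e v₀) ≤ r
    rw [e.dist_map]
    exact hv
  have hmemH : ∀ (v : V) (w : Metric.closedBall v₀ r),
      StrongDual.toWeakDual (e v) ∈ H w ↔ 0 ≤ inner ℝ (f (w : V)) ((w : V) - v) := by
    intro v w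
    change inner ℝ v (f w) ≤ _ ↔ _
    rw [inner_sub_right, sub_nonneg, real_inner_comm]
  obtain ⟨φ, hφC, hφ⟩ := hC.inter_iInter_nonempty H hH (by
    intro s
    rcases s.eq_empty_or_nonempty with rfl | hs
    · exact ⟨_, hmem v₀ (Metric.mem_closedBall_self hr), by simp⟩
    · have : Nonempty s := hs.to_subtype
      obtain ⟨v, hv, hvs⟩ := exists_mem_forall_inner_nonneg_of_finite (convex_closedBall v₀ r) hf
        (fun i : s => ((i : Metric.closedBall v₀ r) : V)) (fun i => i.1.2)
      exact ⟨_, hmem v hv, Set.mem_iInter₂.mpr fun i hi => (hmemH v i).mpr (hvs ⟨i, hi⟩)⟩)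
  obtain ⟨v, hv⟩ := e.surjective (WeakDual.toStrongDual φ)
  have hφv : StrongDual.toWeakDual (e v) = φ := by rw [hv]; rfl
  refine ⟨v, ?_, fun w hw => (hmemH v ⟨w, hw⟩).mp (hφv ▸ Set.mem_iInter.mp hφ ⟨w, hw⟩)⟩
  have h : dist (e v) (e v₀) ≤ r := by rw [hv]; exact hφC
  rwa [e.dist_map] at h

/-- Minty's lemma: for a continuous map the Minty variational inequality implies the Stampacchia
variational inequality. -/
theorem inner_nonneg_of_forall_inner_nonneg {K : Set V} (hK : Convex ℝ K) {f : V → V}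
    (hf : ContinuousOn f K) {v : V} (hv : v ∈ K)
    (h : ∀ w ∈ K, 0 ≤ inner ℝ (f w) (w - v)) : ∀ w ∈ K, 0 ≤ inner ℝ (f v) (w - v) := by
  intro w hw
  have hp : ∀ t ∈ Set.Icc (0 : ℝ) 1, v + t • (w - v) ∈ K := fun t ht =>
    hK.add_smul_sub_mem hv hw ht
  have hpc : ContinuousOn (fun t : ℝ => f (v + t • (w - v))) (Set.Icc 0 1) :=
    hf.comp (by fun_prop) hp
  have hc : ContinuousOn (fun t : ℝ => inner ℝ (f (v + t • (w - v))) (w - v)) (Set.Icc 0 1) :=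
    hpc.inner continuousOn_const
  have ht : Filter.Tendsto (fun t : ℝ => inner ℝ (f (v + t • (w - v))) (w - v)) (𝓝[>] 0)
      (𝓝 (inner ℝ (f v) (w - v))) := by
    have h0 := (hc 0 (by simp)).mono_left
      (nhdsWithin_le_of_mem (Icc_mem_nhdsGT (zero_lt_one' ℝ)))
    simpa using h0
  refine ge_of_tendsto ht ?_
  filter_upwards [Ioc_mem_nhdsGT (zero_lt_one' ℝ)] with t ht
  -- Minty's inequality at `v + t • (w - v)` carries a factor `t`, which is divided out before `t`
  -- tends to `0`.
  have h1 := h _ (hp t ⟨ht.1.le, ht.2⟩)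
  rw [add_sub_cancel_left, inner_smul_right] at h1
  exact nonneg_of_mul_nonneg_right h1 ht.1

/-- A continuous strongly monotone map on a closed ball of a Hilbert space has a zero there, if its
value at the center is small compared to the radius. -/
theorem StronglyMonotoneOn.exists_mem_closedBall_eq_zero [CompleteSpace V] {τ : ℝ≥0} (hτ : 0 < τ)
    {f : V → V} {v₀ : V} {r : ℝ}
    (hf : StronglyMonotoneOn τ f (Metric.closedBall v₀ r))
    (hfc : ContinuousOn f (Metric.closedBall v₀ r)) (hfr : ‖f v₀‖ < τ * r) :
    ∃ v ∈ Metric.closedBall v₀ r, f v = 0 := by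
  have hτ' : (0 : ℝ) < τ := hτ
  have hr : 0 < r := pos_of_mul_pos_right ((norm_nonneg _).trans_lt hfr) hτ'.le
  obtain ⟨v, hv, hmin⟩ := exists_mem_closedBall_forall_inner_nonneg hr.le
    (fun v hv w hw => (by positivity : (0 : ℝ) ≤ τ * ‖v - w‖ ^ 2).trans (hf v hv w hw))
  have hst := inner_nonneg_of_forall_inner_nonneg (convex_closedBall v₀ r) hfc hv hmin
  have hv₀ := Metric.mem_closedBall_self (x := v₀) hr.le
  -- On the sphere, strong monotonicity between `v₀` and `v` would force `τ * r ≤ ‖f v₀‖`.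
  have hlt : ‖v₀ - v‖ < r := by
    by_contra! hle
    have h1 := hf v₀ hv₀ v hv
    have h2 := hst v₀ hv₀
    rw [inner_sub_left] at h1
    have h3 := real_inner_le_norm (f v₀) (v₀ - v)
    have h4 : (τ : ℝ) * r * ‖v₀ - v‖ ≤ τ * ‖v₀ - v‖ ^ 2 := by
      rw [pow_two, ← mul_assoc]
      gcongr
    have h5 := mul_lt_mul_of_pos_right hfr (hr.trans_le hle)
    linarith
  have hnhds : Metric.closedBall v₀ r ∈ 𝓝 v :=
    Filter.mem_of_superset (Metric.isOpen_ball.mem_nhds (by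
      rwa [Metric.mem_ball, dist_comm, dist_eq_norm])) Metric.ball_subset_closedBall
  have htend : Filter.Tendsto (fun t : ℝ => v - t • f v) (𝓝[>] 0) (𝓝 v) := by
    have : Continuous fun t : ℝ => v - t • f v := by fun_prop
    simpa using (this.tendsto 0).mono_left nhdsWithin_le_nhds
  obtain ⟨t, htm, ht⟩ := ((htend.eventually hnhds).and self_mem_nhdsWithin).exists
  refine ⟨v, hv, ?_⟩
  -- As `v` is interior, `v - t • f v` is an admissible test point and gives `-t * ‖f v‖ ^ 2 ≥ 0`.
  have h := hst _ htm
  rw [sub_sub_cancel_left, inner_neg_right, inner_smul_right, real_inner_self_eq_norm_sq] at h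
  have ht : 0 < t := ht
  have h6 : ‖f v‖ ^ 2 ≤ 0 := by
    by_contra! h7
    have := mul_pos ht h7
    linarith
  exact norm_eq_zero.mp (pow_eq_zero_iff two_ne_zero |>.mp (le_antisymm h6 (sq_nonneg _)))

theorem StronglyMonotoneOn.mul_norm_sub_le {τ : ℝ≥0} {f : V → V} {B : Set V}
    (hf : StronglyMonotoneOn τ f B) {v w : V} (hv : v ∈ B) (hw : w ∈ B) :
    τ * ‖v - w‖ ≤ ‖f v - f w‖ := by
  rcases (norm_nonneg (v - w)).eq_or_lt with h | h
  · simp [← h]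
  · refine le_of_mul_le_mul_right ?_ h
    rw [mul_assoc, ← pow_two]
    exact (hf v hv w hw).trans (real_inner_le_norm _ _)

end Hilbert

theorem theorem11 {U V : Type*}
    [NormedAddCommGroup U] [NormedSpace ℝ U] [CompleteSpace U]
    [NormedAddCommGroup V] [InnerProductSpace ℝ V] [CompleteSpace V]
    (D : Set (U × V)) (ψ : U × V → V) (u₀ : U) (v₀ : V)
    (hdom : (u₀, v₀) ∈ interior D) (hzero : ψ (u₀, v₀) = 0)
    (BU : Set U) (BV : Set V) (hBU : BU ∈ 𝓝 u₀) (hBV : BV ∈ 𝓝 v₀)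
    (L τ : ℝ≥0) (hτ : 0 < τ)
    (hcont : ContinuousOn ψ (D ∩ BU ×ˢ BV))
    (hmono : ∀ u ∈ BU, StronglyMonotoneOn τ (fun v => ψ (u, v)) {v ∈ BV | (u, v) ∈ D})
    (hlip : ∀ v ∈ BV, LipschitzOnWith L (fun u => ψ (u, v)) {u | (u, v) ∈ D}) :
    ∃ (Q : Set U) (W : Set V) (s : U → V),
      IsSingleValuedLocalization (solutionMap D ψ) u₀ v₀ Q W s ∧
      LipschitzOnWith (L / τ) s Q := by
  classical
  have hτ' : (0 : ℝ) < τ := hτ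
  have hN : D ∩ BU ×ˢ BV ∈ 𝓝 (u₀, v₀) :=
    Filter.inter_mem (mem_interior_iff_mem_nhds.mp hdom) (prod_mem_nhds hBU hBV)
  obtain ⟨P, hP, W₀, hW₀, hPW⟩ := mem_nhds_prod_iff.mp hN
  obtain ⟨r, hr, hrW⟩ := Metric.nhds_basis_closedBall.mem_iff.mp hW₀
  set W := Metric.closedBall v₀ r
  have hv₀ : v₀ ∈ W := Metric.mem_closedBall_self hr.le
  have hsub : ∀ u ∈ P, ∀ v ∈ W, (u, v) ∈ D ∩ BU ×ˢ BV := fun u hu v hv => hPW ⟨hu, hrW hv⟩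
  have hmonoW : ∀ u ∈ P, StronglyMonotoneOn τ (fun v => ψ (u, v)) W := fun u hu v hv w hw =>
    hmono u (hsub u hu v hv).2.1 v ⟨(hsub u hu v hv).2.2, (hsub u hu v hv).1⟩
      w ⟨(hsub u hu w hw).2.2, (hsub u hu w hw).1⟩
  have hlipW : ∀ u₁ ∈ P, ∀ u₂ ∈ P, ∀ v ∈ W, ‖ψ (u₁, v) - ψ (u₂, v)‖ ≤ L * ‖u₁ - u₂‖ := by
    intro u₁ h₁ u₂ h₂ v hv
    simpa only [dist_eq_norm] using (hlip v (hsub u₁ h₁ v hv).2.2).dist_le_mul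
      u₁ (hsub u₁ h₁ v hv).1 u₂ (hsub u₂ h₂ v hv).1
  -- The bound makes `‖ψ (u, v₀)‖ < τ * r`, the smallness needed for a zero in `W`.
  let Q : Set U := P ∩ {u | (L : ℝ) * ‖u - u₀‖ < τ * r}
  have hQ : Q ∈ 𝓝 u₀ := by
    refine Filter.inter_mem hP (IsOpen.mem_nhds (isOpen_lt (by fun_prop) continuous_const) ?_)
    simpa using mul_pos hτ' hr
  have hu₀P : u₀ ∈ P := mem_of_mem_nhds hP
  have hex : ∀ u ∈ Q, ∃ v ∈ W, ψ (u, v) = 0 := by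
    intro u hu
    refine (hmonoW u hu.1).exists_mem_closedBall_eq_zero hτ
      (hcont.comp (by fun_prop) fun v hv => hsub u hu.1 v hv) (lt_of_le_of_lt ?_ hu.2)
    simpa [hzero] using hlipW u hu.1 u₀ hu₀P v₀ hv₀
  have hest : ∀ u₁ ∈ P, ∀ u₂ ∈ P, ∀ v₁ ∈ W, ∀ v₂ ∈ W, ψ (u₁, v₁) = 0 → ψ (u₂, v₂) = 0 →
      τ * ‖v₁ - v₂‖ ≤ L * ‖u₁ - u₂‖ := by
    intro u₁ hu₁ u₂ hu₂ v₁ hv₁ v₂ hv₂ h₁ h₂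
    -- Both zeros are compared under `ψ (u₁, ·)`; there `ψ (u₁, v₂) = ψ (u₁, v₂) - ψ (u₂, v₂)` is
    -- controlled by the Lipschitz bound.
    refine ((hmonoW u₁ hu₁).mul_norm_sub_le hv₁ hv₂).trans ?_
    have h := hlipW u₁ hu₁ u₂ hu₂ v₂ hv₂
    rw [h₂, sub_zero] at h
    simpa [h₁] using h
  have huniq : ∀ u ∈ P, ∀ v₁ ∈ W, ∀ v₂ ∈ W, ψ (u, v₁) = 0 → ψ (u, v₂) = 0 → v₁ = v₂ := by
    intro u hu v₁ hv₁ v₂ hv₂ h₁ h₂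
    have h := hest u hu u hu v₁ hv₁ v₂ hv₂ h₁ h₂
    rw [sub_self, norm_zero, mul_zero] at h
    exact sub_eq_zero.mp (norm_le_zero_iff.mp (nonpos_of_mul_nonpos_right h hτ'))
  choose! s hsW hs using hex
  refine ⟨Q, W, s, ⟨hQ, Metric.closedBall_mem_nhds v₀ hr, ?_, ?_⟩, ?_⟩
  · have hu₀ := mem_of_mem_nhds hQ
    exact huniq u₀ hu₀P _ (hsW u₀ hu₀) _ hv₀ (hs u₀ hu₀) hzero
  · intro u hu
    ext v
    refine ⟨fun hv => huniq u hu.1 _ hv.2 _ (hsW u hu) hv.1.2 (hs u hu), ?_⟩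
    rintro rfl
    exact ⟨⟨(hsub u hu.1 _ (hsW u hu)).1, hs u hu⟩, hsW u hu⟩
  · refine LipschitzOnWith.of_dist_le_mul fun u₁ hu₁ u₂ hu₂ => ?_
    have h := hest u₁ hu₁.1 u₂ hu₂.1 _ (hsW u₁ hu₁) _ (hsW u₂ hu₂) (hs u₁ hu₁) (hs u₂ hu₂)
    rw [dist_eq_norm, dist_eq_norm, NNReal.coe_div, div_mul_eq_mul_div, le_div_iff₀ hτ', mul_comm]
    exact h
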